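/- A *system* is a pair $(A,\sigma)$ where $A$ is a commutative unital C*-algebra and $\sigma$ is a *-automorphism of $A$. Embeddings of systems are the injective unital *-homomorphisms that intertwine the automorphisms, and isomorphisms are the bijective ones; a *substructure* of $(A,\sigma)$ is a closed unital *-subalgebra $B$ with $\sigma(B)\subseteq B$. Let $\mathcal K$ be the class of systems $(A,\sigma)$ with $A$ nonzero and finite-dimensional. **Theorem 4.1.** (1) $\mathcal K$ is a Fraïssé class. That is, $\mathcal K$ is nonempty, its members are finitely generated, and: * (hereditary property) every finitely generated substructure of a member of $\mathcal K$ is the image of an embedding of a member of $\mathcal K$; * (joint embedding) any two members of $\mathcal K$ embed into a common member of $\mathcal K$; * (amalgamation) for all embeddings $\varphi_i:\mathcal A\to\mathcal B_i$ ($i=1,2$) between members of $\mathcal K$ there are $\mathcal C\in\mathcal K$ and embeddings $\psi_i:\mathcal B_i\to\mathcal C$ with $\psi_1\circ\varphi_1=\psi_2\circ\varphi_2$; * (separability) for every $n$, the $n$-tuples that generate a member of $\mathcal K$ form a separable space under $d(\bar a,\bar b)=\inf_{\varphi,\psi}\max_i\|\varphi(a_i)-\psi(b_i)\|$, where $\varphi,\psi$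 range over all embeddings of the two systems generated by $\bar a,\bar b$ into a common member of $\mathcal K$. (2) There is a homeomorphism $S$ of the Cantor set $2^{\mathbb N}$ such that, with $\sigma(f)=f\circ S$, the system $(C(2^{\mathbb N}),\sigma)$ is a Fraïssé limit of $\mathcal K$, and every Fraïssé limit of $\mathcal K$ is isomorphic to $(C(2^{\mathbb N}),\sigma)$. Here a *Fraïssé limit* of $\mathcal K$ is a separable system $\mathcal M$ such that * $\mathcal M$ is a direct limit of members of $\mathcal K$, i.e. the closure of the union of a nonempty upward directed family of substructures isomorphic to members of $\mathcal K$; * every member of $\mathcal K$ embeds into $\mathcal M$; * for every $\mathcal A\in\mathcal K$, all embeddings $\varphi,\psi:\mathcal A\to\mathcal M$, every finite tuple $\bar a$ in $\mathcal A$ and every $\varepsilon>0$ there is an automorphism $\alpha$ of $\mathcal M$ with $\|\alpha(\varphi(a_i))-\psi(a_i)\|<\varepsilon$ for all $i$. -/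

import Mathlib

universe u v

/-- A commutative unital C*-algebra together with an automorphism. -/
structure CStarSystem where
  carrier : Type u
  [inst : CommCStarAlgebra carrier]
  σ : carrier ≃⋆ₐ[ℂ] carrier

namespace CStarSystem

instance : CoeSort CStarSystem.{u} (Type u) := ⟨carrier⟩

instance (A : CStarSystem.{u}) : CommCStarAlgebra A := A.inst

/-- An embedding of systems: an injective (hence isometric) unital *-homomorphism that
intertwines the automorphisms. -/
structure Emb (A : CStarSystem.{u}) (B : CStarSystem.{v}) where
  toHom : A →⋆ₐ[ℂ] B
  injective : Function.Injective toHom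
  map_σ : ∀ a : A, toHom (A.σ a) = B.σ (toHom a)

instance (A : CStarSystem.{u}) (B : CStarSystem.{v}) : CoeFun (Emb A B) (fun _ => A → B) :=
  ⟨fun φ => φ.toHom⟩

/-- An isomorphism of systems: a *-isomorphism that intertwines the automorphisms. -/
structure Iso (A : CStarSystem.{u}) (B : CStarSystem.{v}) where
  toEquiv : A ≃⋆ₐ[ℂ] B
  map_σ : ∀ a : A, toEquiv (A.σ a) = B.σ (toEquiv a)

instance (A : CStarSystem.{u}) (B : CStarSystem.{v}) : CoeFun (Iso A B) (fun _ => A → B) :=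
  ⟨fun φ => φ.toEquiv⟩

/-- The substructure generated by `s`: the smallest closed unital *-subalgebra that contains `s`
and is mapped into itself by the automorphism. -/
noncomputable def generated (A : CStarSystem.{u}) (s : Set A) : StarSubalgebra ℂ A :=
  sInf {B : StarSubalgebra ℂ A | IsClosed (B : Set A) ∧ (∀ x ∈ B, A.σ x ∈ B) ∧ s ⊆ (B : Set A)}

/-- The system `(C(X), f ↦ f ∘ S)` of a homeomorphism `S` of a compact space `X`. -/
noncomputable def ofHomeo {X : Type u} [TopologicalSpace X] [CompactSpace X] (S : X ≃ₜ X) :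
    CStarSystem.{u} where
  carrier := C(X, ℂ)
  σ := S.compStarAlgEquiv' ℂ ℂ

end CStarSystem

open CStarSystem

section FraisseTheory

variable (K : CStarSystem.{u} → Prop)

/-- A finite-length tuple in a system. -/
structure PointedSystem (n : ℕ) where
  sys : CStarSystem.{u}
  pt : Fin n → sys

/-- The `n`-tuples that generate a member of `K`. -/
def generatingTuples (n : ℕ) : Set (PointedSystem.{u} n) :=
  {x | K x.sys ∧ x.sys.generated (Set.range x.pt) = ⊤}

/-- The distance of two tuples: the infimum of the distances of their images
over all pairs of embeddings into a common member of `K`. -/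
noncomputable def jointEDist {n : ℕ} (x y : PointedSystem.{u} n) : ENNReal :=
  ⨅ (C : CStarSystem.{u}) (_ : K C) (φ : Emb x.sys C) (ψ : Emb y.sys C),
    ⨆ i, edist (φ (x.pt i)) (ψ (y.pt i))

/-- Finitely generated substructures of members of `K` are (isomorphic to) members of `K`. -/
def HereditaryProperty : Prop :=
  ∀ A, K A → ∀ (n : ℕ) (a : Fin n → A), ∃ B, K B ∧ ∃ φ : Emb B A,
    Set.range φ = (A.generated (Set.range a) : Set A)

/-- Any two members of `K` embed into a common member of `K`. -/
def JointEmbeddingProperty : Prop :=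
  ∀ A B, K A → K B → ∃ C, K C ∧ Nonempty (Emb A C) ∧ Nonempty (Emb B C)

/-- Any two embeddings out of a member of `K` can be (exactly) amalgamated in `K`. -/
def AmalgamationProperty : Prop :=
  ∀ A B₁ B₂, K A → K B₁ → K B₂ → ∀ (φ₁ : Emb A B₁) (φ₂ : Emb A B₂),
    ∃ C, K C ∧ ∃ (ψ₁ : Emb B₁ C) (ψ₂ : Emb B₂ C), ∀ a : A, ψ₁ (φ₁ a) = ψ₂ (φ₂ a)

/-- For every `n` the space of generating `n`-tuples of members of `K` is separable. -/
def WeakPolishProperty : Prop :=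
  ∀ n : ℕ, ∃ D : Set (PointedSystem.{u} n), D.Countable ∧ D ⊆ generatingTuples K n ∧
    ∀ x ∈ generatingTuples K n, ∀ ε : ENNReal, 0 < ε → ∃ y ∈ D, jointEDist K x y < ε

/-- Fraïssé classes in the sense of continuous logic. -/
structure IsFraisseClass : Prop where
  nonempty : ∃ A, K A
  finitelyGenerated : ∀ A, K A → ∃ (n : ℕ) (a : Fin n → A), A.generated (Set.range a) = ⊤
  hereditary : HereditaryProperty K
  jointEmbedding : JointEmbeddingProperty K
  amalgamation : AmalgamationProperty K
  weakPolish : WeakPolishProperty K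

/-- `M` is a direct limit of members of `K`: it is the closure of the union of a (nonempty)
upward directed family of substructures that are isomorphic to members of `K`. -/
def IsDirectLimitOf (M : CStarSystem.{v}) : Prop :=
  ∃ F : Set (StarSubalgebra ℂ M), F.Nonempty ∧ DirectedOn (· ≤ ·) F ∧
    (∀ B ∈ F, ∃ A, K A ∧ ∃ φ : Emb A M, Set.range φ = (B : Set M)) ∧
    Dense (⋃ B ∈ F, (B : Set M))

/-- Fraïssé limits in the sense of continuous logic: separable direct limits of members of `K`
that are universal and approximately homogeneous for `K`. -/
structure IsFraisseLimit (M : CStarSystem.{v}) : Prop where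
  separable : TopologicalSpace.SeparableSpace M
  directLimit : IsDirectLimitOf K M
  universal : ∀ A, K A → Nonempty (Emb A M)
  homogeneous : ∀ A, K A → ∀ (φ ψ : Emb A M) (n : ℕ) (a : Fin n → A) (ε : ℝ), 0 < ε →
    ∃ α : Iso M M, ∀ i, ‖α (φ (a i)) - ψ (a i)‖ < ε

end FraisseTheory

/-- The class of (nonzero) finite-dimensional commutative C*-algebras with an automorphism. -/
def FinDimClass (A : CStarSystem.{u}) : Prop :=
  Nontrivial A ∧ FiniteDimensional ℂ A

-- By Gelfand duality a nonzero finite-dimensional system is a permutation of a nonempty finite set,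
-- and an embedding is an equivariant surjection in the opposite direction. Joint embedding and
-- amalgamation become products and fibre products of finite sets (`exists_joint_embedding`),
-- heredity is finite-dimensional linear algebra, and separability holds because there are only
-- countably many permutations of finite sets `Fin n` and each of their systems is separable.
--
-- Limits are controlled by exact extension of embeddings, `HasExtension`. For separable systems in
-- which the finite-dimensional invariant subalgebras have dense union, extension drives a
-- back-and-forth argument, `exists_iso_extending`, which yields both homogeneity and uniqueness.
-- Approximate homogeneity already forces exact extension (`IsFraisseLimit.hasExtension`): a
-- finite-dimensional algebra is spanned by idempotents, and two idempotents of a commutative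
-- algebra at distance less than 1 are equal.
--
-- The concrete limit is the simultaneous rotation of all finite cycles, each multiplied by a Cantor
-- space that is left fixed; the product of these is a Cantor set. Extension is dually the lifting
-- statement `CyclicCantor.exists_lift`. A map to a finite system depends on finitely many
-- coordinates, so the Cantor factor of a further coordinate can select points in the fibres of the
-- given surjection, and a cycle whose length is the order of the upstairs permutation serves as a
-- clock that makes the selection equivariant.

universe w

open WeakDual

namespace CStarSystem

/-! ### Formal properties of embeddings and isomorphisms. -/

/-- The composition of two embeddings. -/
noncomputable def Emb.comp {A : CStarSystem.{u}} {B : CStarSystem.{v}} {C : CStarSystem.{w}}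
    (ψ : Emb B C) (φ : Emb A B) : Emb A C where
  toHom := ψ.toHom.comp φ.toHom
  injective := ψ.injective.comp φ.injective
  map_σ a := by simp [φ.map_σ, ψ.map_σ]

theorem Emb.isometry {A : CStarSystem.{u}} {B : CStarSystem.{v}} (φ : Emb A B) : Isometry φ :=
  NonUnitalStarAlgHom.isometry φ.toHom φ.injective

theorem Emb.norm_map {A : CStarSystem.{u}} {B : CStarSystem.{v}} (φ : Emb A B) (a : A) :
    ‖φ a‖ = ‖a‖ :=
  NonUnitalStarAlgHom.norm_map φ.toHom φ.injective a

/-- An isomorphism as an embedding. -/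
noncomputable def Iso.toEmb {A : CStarSystem.{u}} {B : CStarSystem.{v}} (e : Iso A B) :
    Emb A B where
  toHom := e.toEquiv.toStarAlgHom
  injective := e.toEquiv.injective
  map_σ := e.map_σ

/-- The inverse of an isomorphism. -/
noncomputable def Iso.symm {A : CStarSystem.{u}} {B : CStarSystem.{v}} (e : Iso A B) :
    Iso B A where
  toEquiv := e.toEquiv.symm
  map_σ b := by
    apply EquivLike.injective e.toEquiv
    rw [e.map_σ, StarAlgEquiv.apply_symm_apply, StarAlgEquiv.apply_symm_apply]

theorem Iso.apply_symm_apply {A : CStarSystem.{u}} {B : CStarSystem.{v}} (e : Iso A B) (b : B) :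
    e (e.symm b) = b :=
  e.toEquiv.apply_symm_apply b

theorem Iso.symm_apply_apply {A : CStarSystem.{u}} {B : CStarSystem.{v}} (e : Iso A B) (a : A) :
    e.symm (e a) = a :=
  e.toEquiv.symm_apply_apply a

/-- The identity isomorphism. -/
noncomputable def Iso.refl (A : CStarSystem.{u}) : Iso A A where
  toEquiv := StarAlgEquiv.refl ℂ A
  map_σ _ := rfl

/-- An embedding whose range lies in the range of another one factors through it. -/
theorem Emb.exists_factor {A : CStarSystem.{u}} {B : CStarSystem.{v}} {M : CStarSystem.{w}}
    (φ : Emb A M) (χ : Emb B M) (h : Set.range φ ⊆ Set.range χ) :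
    ∃ ι : Emb A B, ∀ a, χ (ι a) = φ a := by
  have hmem : ∀ a, φ.toHom a ∈ χ.toHom.range := fun a => by
    obtain ⟨b, hb⟩ := h ⟨a, rfl⟩
    exact ⟨b, hb⟩
  let e := StarAlgEquiv.ofInjective χ.toHom χ.injective
  let g : A →⋆ₐ[ℂ] B := e.symm.toStarAlgHom.comp (φ.toHom.codRestrict _ hmem)
  have hg : ∀ a, χ (g a) = φ a := fun a => by
    have : e (g a) = φ.toHom.codRestrict _ hmem a := e.apply_symm_apply _
    exact congrArg Subtype.val this
  refine ⟨⟨g, fun a b hab => φ.injective ?_, fun a => χ.injective ?_⟩, hg⟩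
  · rw [← hg a, ← hg b, hab]
  · rw [hg, φ.map_σ, χ.map_σ, hg]

/-! ### Gelfand duality for systems. -/

/-- The action of the automorphism on characters. -/
noncomputable def specHomeo (A : CStarSystem.{u}) :
    characterSpace ℂ A ≃ₜ characterSpace ℂ A where
  toFun := CharacterSpace.compContinuousMap A.σ.toStarAlgHom
  invFun := CharacterSpace.compContinuousMap A.σ.symm.toStarAlgHom
  left_inv x := CharacterSpace.ext fun a => congrArg x (A.σ.apply_symm_apply a)
  right_inv x := CharacterSpace.ext fun a => congrArg x (A.σ.symm_apply_apply a)
  continuous_toFun := ContinuousMap.continuous _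
  continuous_invFun := ContinuousMap.continuous _

theorem specHomeo_apply (A : CStarSystem.{u}) (x : characterSpace ℂ A) (a : A) :
    A.specHomeo x a = x (A.σ a) := rfl

/-- The dual of an embedding, as a map of character spaces. -/
noncomputable def Emb.dual {A : CStarSystem.{u}} {B : CStarSystem.{v}} (φ : Emb A B) :
    C(characterSpace ℂ B, characterSpace ℂ A) :=
  CharacterSpace.compContinuousMap φ.toHom

theorem Emb.dual_apply {A : CStarSystem.{u}} {B : CStarSystem.{v}} (φ : Emb A B)
    (x : characterSpace ℂ B) (a : A) : φ.dual x a = x (φ a) := rfl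

theorem Emb.dual_specHomeo {A : CStarSystem.{u}} {B : CStarSystem.{v}} (φ : Emb A B)
    (x : characterSpace ℂ B) : φ.dual (B.specHomeo x) = A.specHomeo (φ.dual x) :=
  CharacterSpace.ext fun a => by
    rw [Emb.dual_apply, specHomeo_apply, specHomeo_apply, Emb.dual_apply, φ.map_σ]

theorem eq_zero_of_characters {A : Type u} [CommCStarAlgebra A] {a : A}
    (h : ∀ x : characterSpace ℂ A, x a = 0) : a = 0 := by
  apply EquivLike.injective (gelfandStarTransform A)
  ext x
  rw [gelfandStarTransform_apply_apply, h, map_zero, ContinuousMap.zero_apply]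

/-- A finite character space is discrete, so the indicator of an omitted point would be a nonzero
element killed by every character in `P`. -/
theorem eq_univ_of_separating {A : Type u} [CommCStarAlgebra A] [Finite (characterSpace ℂ A)]
    (P : Set (characterSpace ℂ A)) (h : ∀ a : A, (∀ x ∈ P, x a = 0) → a = 0) (x₀) : x₀ ∈ P := by
  classical
  by_contra hx
  let f : C(characterSpace ℂ A, ℂ) :=
    ⟨fun x => if x = x₀ then 1 else 0, continuous_of_discreteTopology⟩
  have hf : ∀ x : characterSpace ℂ A, x ((gelfandStarTransform A).symm f) = f x := fun x => by
    rw [← gelfandStarTransform_apply_apply, StarAlgEquiv.apply_symm_apply]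
  have h0 := h ((gelfandStarTransform A).symm f) fun x hxP => by
    rw [hf]
    exact if_neg fun hxx : x = x₀ => hx (hxx ▸ hxP)
  have h1 := hf x₀
  rw [h0, map_zero] at h1
  simp [f] at h1

theorem Emb.dual_surjective {A : CStarSystem.{u}} {B : CStarSystem.{v}} (φ : Emb A B)
    [Finite (characterSpace ℂ A)] : Function.Surjective φ.dual :=
  eq_univ_of_separating (Set.range φ.dual) fun a ha => by
    apply φ.injective
    rw [map_zero]
    exact eq_zero_of_characters fun x => ha _ ⟨x, rfl⟩

/-- An equivariant continuous surjection onto the character space gives an embedding. -/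
noncomputable def embOfSpec {X : Type u} [TopologicalSpace X] [CompactSpace X] (S : X ≃ₜ X)
    (A : CStarSystem.{v}) (f : C(X, characterSpace ℂ A)) (hf : Function.Surjective f)
    (h : ∀ x, f (S x) = A.specHomeo (f x)) : Emb A (ofHomeo S) where
  toHom := (ContinuousMap.compStarAlgHom' ℂ ℂ f).comp (gelfandStarTransform A).toStarAlgHom
  injective := by
    refine (injective_iff_map_eq_zero _).2 fun a ha => eq_zero_of_characters fun x => ?_
    obtain ⟨y, rfl⟩ := hf x
    exact DFunLike.congr_fun (F := C(X, ℂ)) ha y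
  map_σ a := ContinuousMap.ext fun x => (DFunLike.congr_fun (h x) a).symm

/-- A homeomorphism with the character space that conjugates the actions gives an
isomorphism. -/
noncomputable def isoOfSpec {X : Type u} [TopologicalSpace X] [CompactSpace X] (S : X ≃ₜ X)
    (A : CStarSystem.{v}) (f : X ≃ₜ characterSpace ℂ A)
    (h : ∀ x, f (S x) = A.specHomeo (f x)) : Iso A (ofHomeo S) where
  toEquiv := (gelfandStarTransform A).trans (f.compStarAlgEquiv' ℂ ℂ)
  map_σ a := ContinuousMap.ext fun x => (DFunLike.congr_fun (h x) a).symm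

/-- Characters are algebra homomorphisms to `ℂ`, and a finite-dimensional algebra has only finitely
many of these. -/
theorem finite_characterSpace (A : Type u) [CommCStarAlgebra A] [FiniteDimensional ℂ A] :
    Finite (characterSpace ℂ A) :=
  Finite.of_injective (fun x => CharacterSpace.toAlgHom x : characterSpace ℂ A → (A →ₐ[ℂ] ℂ))
    fun _ _ h => CharacterSpace.ext fun a => DFunLike.congr_fun h a

theorem finDimClass_ofHomeo {X : Type u} [TopologicalSpace X] [CompactSpace X] [Finite X]
    [Nonempty X] (S : X ≃ₜ X) : FinDimClass (ofHomeo S) :=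
  ⟨inferInstanceAs (Nontrivial C(X, ℂ)),
    FiniteDimensional.of_injective (V := C(X, ℂ))
      (ContinuousMap.coeFnLinearMap ℂ : C(X, ℂ) →ₗ[ℂ] (X → ℂ)) DFunLike.coe_injective⟩

/-- The system of a permutation of a finite set. -/
noncomputable def ofPerm (n : ℕ) (π : Equiv.Perm (Fin n)) : CStarSystem.{u} :=
  ofHomeo (X := ULift.{u} (Fin n))
    (Homeomorph.ulift.trans ((π.toHomeomorphOfDiscrete).trans Homeomorph.ulift.symm))

/-- Every finite-dimensional system is given by a permutation of a finite set. -/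
theorem exists_iso_ofPerm (A : CStarSystem.{v}) (hA : FinDimClass A) :
    ∃ (n : ℕ) (π : Equiv.Perm (Fin n)),
      FinDimClass (ofPerm.{u} n π) ∧ Nonempty (Iso A (ofPerm.{u} n π)) := by
  obtain ⟨_, _⟩ := hA
  have := finite_characterSpace A
  obtain ⟨n, ⟨e⟩⟩ := Finite.exists_equiv_fin (characterSpace ℂ A)
  have : Nonempty (ULift.{u} (Fin n)) := ⟨⟨e (Classical.arbitrary _)⟩⟩
  refine ⟨n, (e.symm.trans A.specHomeo.toEquiv).trans e, finDimClass_ofHomeo _,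
    ⟨isoOfSpec _ A (Homeomorph.ulift.trans e.symm.toHomeomorphOfDiscrete) fun x => ?_⟩⟩
  exact e.symm_apply_apply _

/-! ### Finite-dimensional invariant subalgebras. -/

/-- Finite-dimensional star subalgebras that are mapped into themselves by the automorphism. -/
structure IsFinInvariant {M : CStarSystem.{v}} (B : StarSubalgebra ℂ M) : Prop where
  finite : FiniteDimensional ℂ B
  map_mem : ∀ x ∈ B, M.σ x ∈ B

/-- The restricted automorphism is injective on a finite-dimensional space, hence onto, so `B` is
itself a system. Replacing it by a permutation system moves it from the universe of `M` to that of
the class. -/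
theorem IsFinInvariant.exists_emb {M : CStarSystem.{v}} [Nontrivial M]
    {B : StarSubalgebra ℂ M} (hB : IsFinInvariant B) :
    ∃ A : CStarSystem.{u}, FinDimClass A ∧ ∃ φ : Emb A M, Set.range φ = (B : Set M) := by
  have hfin := hB.finite
  have hcl : IsClosed (B : Set M) :=
    Submodule.closed_of_finiteDimensional (Subalgebra.toSubmodule B.toSubalgebra)
  let g : B →⋆ₐ[ℂ] B := (M.σ.toStarAlgHom.comp B.subtype).codRestrict B
    fun x => hB.map_mem _ x.2
  have hg : Function.Injective g := fun x y h =>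
    Subtype.ext (M.σ.injective (congrArg Subtype.val h))
  have hg' : Function.Surjective g :=
    LinearMap.surjective_of_injective (f := g.toAlgHom.toLinearMap) hg
  let D : CStarSystem.{v} := ⟨B, StarAlgEquiv.ofBijective g ⟨hg, hg'⟩⟩
  have hD : FinDimClass D := ⟨inferInstanceAs (Nontrivial B), hfin⟩
  obtain ⟨n, π, hA, ⟨e⟩⟩ := exists_iso_ofPerm.{u} D hD
  let s : Emb D M := ⟨B.subtype, Subtype.val_injective, fun a => rfl⟩
  refine ⟨_, hA, s.comp e.symm.toEmb, ?_⟩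
  ext x
  constructor
  · rintro ⟨a, rfl⟩
    exact (e.symm a).2
  · intro hx
    exact ⟨e (⟨x, hx⟩ : B), congrArg s (e.symm_apply_apply _)⟩

theorem isFinInvariant_range {A : Type u} [CommCStarAlgebra A] [FiniteDimensional ℂ A]
    {M : CStarSystem.{v}} (g : A →⋆ₐ[ℂ] M) (hg : ∀ a, ∃ b, g b = M.σ (g a)) :
    IsFinInvariant g.range where
  finite := inferInstanceAs (FiniteDimensional ℂ (LinearMap.range g.toAlgHom.toLinearMap))
  map_mem := by
    rintro _ ⟨a, rfl⟩
    exact hg a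

theorem Emb.isFinInvariant_range {A : CStarSystem.{u}} {M : CStarSystem.{v}}
    [FiniteDimensional ℂ A] (φ : Emb A M) : IsFinInvariant φ.toHom.range :=
  CStarSystem.isFinInvariant_range φ.toHom fun a => ⟨A.σ a, φ.map_σ a⟩

/-- Commutativity is essential: the products of elements of `B` and `C` span the algebra they
generate. That algebra is closed under `star`, so it contains the join of star subalgebras. -/
theorem IsFinInvariant.sup {M : CStarSystem.{v}} {B C : StarSubalgebra ℂ M}
    (hB : IsFinInvariant B) (hC : IsFinInvariant C) : IsFinInvariant (B ⊔ C) where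
  finite := by
    have hb : FiniteDimensional ℂ B.toSubalgebra := hB.finite
    have hc : FiniteDimensional ℂ C.toSubalgebra := hC.finite
    have hfin := Subalgebra.finite_sup B.toSubalgebra C.toSubalgebra
    have hstar : B.toSubalgebra ⊔ C.toSubalgebra ≤ star (B.toSubalgebra ⊔ C.toSubalgebra) :=
      sup_le (fun x hx => le_sup_left (a := B.toSubalgebra) (star_mem (s := B) hx))
        (fun x hx => le_sup_right (b := C.toSubalgebra) (star_mem (s := C) hx))
    let T : StarSubalgebra ℂ M := ⟨B.toSubalgebra ⊔ C.toSubalgebra, fun hx => hstar hx⟩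
    have hle : B ⊔ C ≤ T := sup_le (fun x hx => le_sup_left (a := B.toSubalgebra) hx)
      (fun x hx => le_sup_right (b := C.toSubalgebra) hx)
    have : FiniteDimensional ℂ (Subalgebra.toSubmodule T.toSubalgebra) := hfin
    exact Submodule.finiteDimensional_of_le
      (S₁ := Subalgebra.toSubmodule (B ⊔ C).toSubalgebra)
      (S₂ := Subalgebra.toSubmodule T.toSubalgebra) hle
  map_mem := by
    have h : B ⊔ C ≤ (B ⊔ C).comap M.σ.toStarAlgHom :=
      sup_le (fun x hx => StarSubalgebra.mem_sup_left (hB.map_mem x hx))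
        (fun x hx => StarSubalgebra.mem_sup_right (hC.map_mem x hx))
    exact fun x hx => h hx

theorem subset_generated (A : CStarSystem.{u}) (s : Set A) :
    s ⊆ (A.generated s : Set A) := fun _ hx =>
  StarSubalgebra.mem_sInf.2 fun _ hB => hB.2.2 hx

theorem map_mem_generated (A : CStarSystem.{u}) (s : Set A) {x : A} (hx : x ∈ A.generated s) :
    A.σ x ∈ A.generated s :=
  StarSubalgebra.mem_sInf.2 fun B hB => hB.2.1 _ (StarSubalgebra.mem_sInf.1 hx B hB)

theorem Iso.generated_eq_top {A : CStarSystem.{u}} {B : CStarSystem.{v}} (e : Iso A B)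
    {s : Set A} (hs : A.generated s = ⊤) : B.generated (e '' s) = ⊤ := by
  refine StarSubalgebra.eq_top_iff.2 fun b => StarSubalgebra.mem_sInf.2 fun T hT => ?_
  have h : A.generated s ≤ T.comap e.toEquiv.toStarAlgHom := by
    refine sInf_le ⟨hT.1.preimage e.toEmb.isometry.continuous, fun x hx => ?_,
      fun x hx => hT.2.2 ⟨x, hx, rfl⟩⟩
    change e (A.σ x) ∈ T
    rw [e.map_σ]
    exact hT.2.1 _ hx
  have hb : e.symm b ∈ A.generated s := hs ▸ StarSubalgebra.mem_top
  have := h hb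
  change e (e.symm b) ∈ T at this
  rwa [e.apply_symm_apply] at this

/-! ### The Fraïssé class axioms. -/

/-- Two finite-dimensional systems embed jointly along every invariant correspondence between
their character spaces with surjective projections. -/
theorem exists_joint_embedding (B₁ B₂ : CStarSystem.{u}) (h₁ : FinDimClass B₁)
    (h₂ : FinDimClass B₂) (P : characterSpace ℂ B₁ → characterSpace ℂ B₂ → Prop)
    (hP : ∀ x y, P x y ↔ P (B₁.specHomeo x) (B₂.specHomeo y))
    (hl : ∀ x, ∃ y, P x y) (hr : ∀ y, ∃ x, P x y) :
    ∃ C : CStarSystem.{u}, FinDimClass C ∧ ∃ (ψ₁ : Emb B₁ C) (ψ₂ : Emb B₂ C), ∀ b₁ b₂,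
      (∀ x y, P x y → x b₁ = y b₂) → ψ₁ b₁ = ψ₂ b₂ := by
  obtain ⟨_, _⟩ := h₁
  obtain ⟨_, _⟩ := h₂
  have := finite_characterSpace B₁
  have := finite_characterSpace B₂
  -- The common extension is the function algebra of the correspondence itself, with the product
  -- action; the coordinate projections are dual to the two embeddings.
  let X := {p : characterSpace ℂ B₁ × characterSpace ℂ B₂ // P p.1 p.2}
  have hne : Nonempty X := by
    let x : characterSpace ℂ B₁ := Classical.arbitrary _
    obtain ⟨y, hy⟩ := hl x
    exact ⟨⟨(x, y), hy⟩⟩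
  let S : X ≃ₜ X := Equiv.toHomeomorphOfDiscrete <|
    (B₁.specHomeo.toEquiv.prodCongr B₂.specHomeo.toEquiv).subtypeEquiv fun p => hP p.1 p.2
  have h₁ : Function.Surjective fun p : X => p.1.1 := fun x => by
    obtain ⟨y, hy⟩ := hl x
    exact ⟨⟨(x, y), hy⟩, rfl⟩
  have h₂ : Function.Surjective fun p : X => p.1.2 := fun y => by
    obtain ⟨x, hx⟩ := hr y
    exact ⟨⟨(x, y), hx⟩, rfl⟩
  let ψ₁ := embOfSpec S B₁ ⟨fun p => p.1.1, continuous_of_discreteTopology⟩ h₁ fun _ => rfl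
  let ψ₂ := embOfSpec S B₂ ⟨fun p => p.1.2, continuous_of_discreteTopology⟩ h₂ fun _ => rfl
  exact ⟨ofHomeo S, finDimClass_ofHomeo S, ψ₁, ψ₂, fun b₁ b₂ h =>
    ContinuousMap.ext (X := X) (Y := ℂ) fun p => h _ _ p.2⟩

theorem jointEmbeddingProperty_finDimClass : JointEmbeddingProperty FinDimClass.{u} := by
  intro A B hA hB
  have := hA.1
  have := hB.1
  obtain ⟨C, hC, ψ₁, ψ₂, -⟩ := exists_joint_embedding A B hA hB (fun _ _ => True)
    (fun _ _ => Iff.rfl) (fun _ => ⟨Classical.arbitrary _, trivial⟩)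
    (fun _ => ⟨Classical.arbitrary _, trivial⟩)
  exact ⟨C, hC, ⟨ψ₁⟩, ⟨ψ₂⟩⟩

/-- The correspondence is the fibre product of the spectra over the spectrum of `A`; its projections
are onto because the dual maps are. -/
theorem amalgamationProperty_finDimClass : AmalgamationProperty FinDimClass.{u} := by
  intro A B₁ B₂ hA h₁ h₂ φ₁ φ₂
  have := hA.2
  have := finite_characterSpace A
  obtain ⟨C, hC, ψ₁, ψ₂, h⟩ := exists_joint_embedding B₁ B₂ h₁ h₂
    (fun x y => φ₁.dual x = φ₂.dual y)
    (fun x y => by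
      rw [φ₁.dual_specHomeo, φ₂.dual_specHomeo, A.specHomeo.injective.eq_iff])
    (fun x => (φ₂.dual_surjective (φ₁.dual x)).imp fun _ h => h.symm)
    (fun y => φ₁.dual_surjective (φ₂.dual y))
  exact ⟨C, hC, ψ₁, ψ₂, fun a => h _ _ fun x y hxy => DFunLike.congr_fun hxy a⟩

theorem hereditaryProperty_finDimClass : HereditaryProperty FinDimClass.{u} := by
  intro A hA n a
  obtain ⟨_, _⟩ := hA
  exact IsFinInvariant.exists_emb
    ⟨FiniteDimensional.finiteDimensional_submodule
      (Subalgebra.toSubmodule (A.generated (Set.range a)).toSubalgebra),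
      fun x hx => A.map_mem_generated _ hx⟩

theorem finitelyGenerated_finDimClass (A : CStarSystem.{u}) (hA : FinDimClass A) :
    ∃ (n : ℕ) (a : Fin n → A), A.generated (Set.range a) = ⊤ := by
  obtain ⟨_, _⟩ := hA
  refine ⟨_, Module.finBasis ℂ A, StarSubalgebra.eq_top_iff.2 fun x => ?_⟩
  have h : Submodule.span ℂ (Set.range (Module.finBasis ℂ A)) ≤
      Subalgebra.toSubmodule (A.generated (Set.range (Module.finBasis ℂ A))).toSubalgebra :=
    Submodule.span_le.2 (A.subset_generated _)
  exact h (by rw [Module.Basis.span_eq]; trivial)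

theorem weakPolishProperty_finDimClass : WeakPolishProperty FinDimClass.{u} := by
  intro n
  let T : (m : ℕ) → (π : Equiv.Perm (Fin m)) → Set (Fin n → ofPerm.{u} m π) := fun m π =>
    {a | FinDimClass (ofPerm.{u} m π) ∧ (ofPerm.{u} m π).generated (Set.range a) = ⊤}
  have hsep : ∀ m π, TopologicalSpace.IsSeparable (T m π) := fun m π => by
    have : TopologicalSpace.SeparableSpace (ofPerm.{u} m π) :=
      inferInstanceAs (TopologicalSpace.SeparableSpace C(ULift.{u} (Fin m), ℂ))
    exact TopologicalSpace.IsSeparable.of_separableSpace _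
  have hD : ∀ m π, ∃ D ⊆ T m π, D.Countable ∧ T m π ⊆ closure D := fun m π =>
    (hsep m π).exists_countable_dense_subset
  choose D hDT hDc hDd using hD
  refine ⟨⋃ m, ⋃ π, PointedSystem.mk (ofPerm.{u} m π) '' D m π,
    Set.countable_iUnion fun m => Set.countable_iUnion fun π => (hDc m π).image _, ?_, ?_⟩
  · simp only [Set.iUnion_subset_iff, Set.image_subset_iff]
    exact fun m π a ha => hDT m π ha
  · rintro ⟨A, a⟩ ⟨hA, ha⟩ ε hε
    obtain ⟨m, π, hm, ⟨e⟩⟩ := exists_iso_ofPerm.{u} A hA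
    have hmem : (fun i => e (a i)) ∈ T m π := by
      refine ⟨hm, ?_⟩
      have := e.generated_eq_top ha
      rwa [← Set.range_comp] at this
    obtain ⟨b, hb, hlt⟩ := EMetric.mem_closure_iff.1 (hDd m π hmem) ε hε
    refine ⟨⟨_, b⟩, Set.mem_iUnion₂.2 ⟨m, π, b, hb, rfl⟩, lt_of_le_of_lt ?_ hlt⟩
    -- Embedding the first tuple by `e` and the second by the identity bounds the infimum by the
    -- distance inside one permutation system.
    refine iInf_le_of_le (ofPerm.{u} m π) (iInf_le_of_le hm (iInf_le_of_le e.toEmb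
      (iInf_le_of_le (Iso.refl _).toEmb (iSup_le fun i => ?_))))
    exact edist_le_pi_edist (fun i => (e (a i) : ofPerm.{u} m π)) b i

theorem isFraisseClass_finDimClass : IsFraisseClass FinDimClass.{u} where
  nonempty := ⟨_, finDimClass_ofHomeo (Homeomorph.refl PUnit.{u + 1})⟩
  finitelyGenerated := finitelyGenerated_finDimClass
  hereditary := hereditaryProperty_finDimClass
  jointEmbedding := jointEmbeddingProperty_finDimClass
  amalgamation := amalgamationProperty_finDimClass
  weakPolish := weakPolishProperty_finDimClass

/-! ### Extension property and back-and-forth. -/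

/-- The finite-dimensional invariant star subalgebras have dense union. -/
def IsLocallyFinite (M : CStarSystem.{v}) : Prop :=
  Dense {x : M | ∃ B : StarSubalgebra ℂ M, IsFinInvariant B ∧ x ∈ B}

/-- Embeddings of finite-dimensional systems extend to larger finite-dimensional systems. -/
def HasExtension (M : CStarSystem.{v}) : Prop :=
  ∀ A B : CStarSystem.{u}, FinDimClass A → FinDimClass B → ∀ (ι : Emb A B) (φ : Emb A M),
    ∃ ψ : Emb B M, ∀ a, ψ (ι a) = φ a

/-- Star subalgebras of `M × N` that are graphs of isomorphisms between finite-dimensional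
substructures. -/
def IsPartialIso (M : CStarSystem.{v}) (N : CStarSystem.{w})
    (Γ : StarSubalgebra ℂ (M × N)) : Prop :=
  ∃ A : CStarSystem.{u}, FinDimClass A ∧ ∃ (φ : Emb A M) (ψ : Emb A N),
    (Γ : Set (M × N)) = Set.range fun a => (φ a, ψ a)

/-- One step of the back-and-forth: enlarge the image of `φ` to its join with `B`, which is still
finite-dimensional, and extend `ψ` along this inclusion. -/
theorem exists_extension {M : CStarSystem.{v}} {N : CStarSystem.{w}} (hN : HasExtension.{u} N)
    {A : CStarSystem.{u}} (hA : FinDimClass A) (φ : Emb A M) (ψ : Emb A N)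
    {B : StarSubalgebra ℂ M} (hB : IsFinInvariant B) :
    ∃ A' : CStarSystem.{u}, FinDimClass A' ∧ ∃ (ι : Emb A A') (φ' : Emb A' M) (ψ' : Emb A' N),
      (∀ a, φ' (ι a) = φ a) ∧ (∀ a, ψ' (ι a) = ψ a) ∧ (B : Set M) ⊆ Set.range φ' := by
  have := hA.1
  have := hA.2
  have : Nontrivial M := φ.injective.nontrivial
  obtain ⟨A', hA', φ', hφ'⟩ := (φ.isFinInvariant_range.sup hB).exists_emb
  obtain ⟨ι, hι⟩ := φ.exists_factor φ' (by
    rw [hφ']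
    rintro _ ⟨a, rfl⟩
    exact StarSubalgebra.mem_sup_left ⟨a, rfl⟩)
  obtain ⟨ψ', hψ'⟩ := hN A A' hA hA' ι ψ
  refine ⟨A', hA', ι, φ', ψ', hι, hψ', ?_⟩
  rw [hφ']
  exact fun x hx => StarSubalgebra.mem_sup_right hx

theorem exists_isPartialIso {M : CStarSystem.{v}} {N : CStarSystem.{w}} {A : CStarSystem.{u}}
    (hA : FinDimClass A) (φ : Emb A M) (ψ : Emb A N) :
    ∃ Γ, IsPartialIso.{u} M N Γ ∧ ∀ p, p ∈ Γ ↔ ∃ a, (φ a, ψ a) = p :=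
  ⟨(φ.toHom.prod ψ.toHom).range, ⟨A, hA, φ, ψ, rfl⟩, fun _ => Iff.rfl⟩

theorem IsPartialIso.extend_left {M : CStarSystem.{v}} {N : CStarSystem.{w}}
    (hN : HasExtension.{u} N) {Γ : StarSubalgebra ℂ (M × N)} (hΓ : IsPartialIso.{u} M N Γ)
    {B : StarSubalgebra ℂ M} (hB : IsFinInvariant B) :
    ∃ Γ', IsPartialIso.{u} M N Γ' ∧ Γ ≤ Γ' ∧ ∀ x ∈ B, ∃ y, (x, y) ∈ Γ' := by
  obtain ⟨A, hA, φ, ψ, hΓ⟩ := hΓ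
  obtain ⟨A', hA', ι, φ', ψ', hφ, hψ, hB'⟩ := exists_extension hN hA φ ψ hB
  obtain ⟨Γ', hΓ', hmem⟩ := exists_isPartialIso hA' φ' ψ'
  refine ⟨Γ', hΓ', fun p hp => ?_, fun x hx => ?_⟩
  · obtain ⟨a, rfl⟩ := hΓ.subset hp
    exact (hmem _).2 ⟨ι a, by rw [hφ, hψ]⟩
  · obtain ⟨a, rfl⟩ := hB' hx
    exact ⟨ψ' a, (hmem _).2 ⟨a, rfl⟩⟩

theorem IsPartialIso.extend_right {M : CStarSystem.{v}} {N : CStarSystem.{w}}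
    (hM : HasExtension.{u} M) {Γ : StarSubalgebra ℂ (M × N)} (hΓ : IsPartialIso.{u} M N Γ)
    {B : StarSubalgebra ℂ N} (hB : IsFinInvariant B) :
    ∃ Γ', IsPartialIso.{u} M N Γ' ∧ Γ ≤ Γ' ∧ ∀ y ∈ B, ∃ x, (x, y) ∈ Γ' := by
  obtain ⟨A, hA, φ, ψ, hΓ⟩ := hΓ
  obtain ⟨A', hA', ι, ψ', φ', hψ, hφ, hB'⟩ := exists_extension hM hA ψ φ hB
  obtain ⟨Γ', hΓ', hmem⟩ := exists_isPartialIso hA' φ' ψ'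
  refine ⟨Γ', hΓ', fun p hp => ?_, fun y hy => ?_⟩
  · obtain ⟨a, rfl⟩ := hΓ.subset hp
    exact (hmem _).2 ⟨ι a, by rw [hφ, hψ]⟩
  · obtain ⟨a, rfl⟩ := hB' hy
    exact ⟨φ' a, (hmem _).2 ⟨a, rfl⟩⟩

/-- An injective *-homomorphism is isometric, so its range is complete, hence closed; being dense,
it is everything. -/
theorem bijective_of_isometric {M : Type v} {N : Type w} [CommCStarAlgebra M]
    [CommCStarAlgebra N] {Γ : StarSubalgebra ℂ N} [IsClosed (Γ : Set N)] (g : Γ →⋆ₐ[ℂ] M)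
    (hg : Function.Injective g) (hd : DenseRange g) : Function.Bijective g := by
  have hiso : Isometry g := NonUnitalStarAlgHom.isometry g hg
  refine ⟨hg, fun x => ?_⟩
  have : x ∈ closure (Set.range g) := hd x
  rwa [hiso.isClosedEmbedding.isClosed_range.closure_eq] at this

/-- The closure of an invariant isometric correspondence with dense projections is the graph of
an isomorphism. -/
theorem exists_iso_of_graph {M : CStarSystem.{v}} {N : CStarSystem.{w}}
    (Γ : StarSubalgebra ℂ (M × N)) (hnorm : ∀ p ∈ Γ, ‖p.1‖ = ‖p.2‖)
    (hσ : ∀ p ∈ Γ, (M.σ p.1, N.σ p.2) ∈ Γ) (hM : Dense (Prod.fst '' (Γ : Set (M × N))))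
    (hN : Dense (Prod.snd '' (Γ : Set (M × N)))) :
    ∃ e : Iso M N, ∀ p ∈ Γ, e p.1 = p.2 := by
  let T := Γ.topologicalClosure
  have hTc : IsClosed (T : Set (M × N)) := Γ.isClosed_topologicalClosure
  have hTe : (T : Set (M × N)) = closure Γ := Γ.topologicalClosure_coe
  -- Equality of norms passes to the closure and makes both coordinate projections of `T` injective:
  -- if one coordinate vanishes, so does the other.
  have hTn : ∀ p ∈ T, ‖p.1‖ = ‖p.2‖ := fun p hp =>
    closure_minimal (s := (Γ : Set (M × N))) hnorm
      (isClosed_eq continuous_fst.norm continuous_snd.norm) (hTe.subset hp)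
  have hMc : Continuous M.σ := (NonUnitalStarAlgHom.isometry M.σ (EquivLike.injective _)).continuous
  have hNc : Continuous N.σ := (NonUnitalStarAlgHom.isometry N.σ (EquivLike.injective _)).continuous
  have hTσ : ∀ p ∈ T, (M.σ p.1, N.σ p.2) ∈ T := fun p hp => by
    rw [← SetLike.mem_coe, hTe] at hp ⊢
    exact map_mem_closure (f := fun p : M × N => (M.σ p.1, N.σ p.2))
      ((hMc.comp continuous_fst).prodMk (hNc.comp continuous_snd)) hp hσ
  let g₁ : T →⋆ₐ[ℂ] M := (StarAlgHom.fst ℂ M N).comp T.subtype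
  let g₂ : T →⋆ₐ[ℂ] N := (StarAlgHom.snd ℂ M N).comp T.subtype
  have hg₁ : Function.Bijective g₁ := by
    refine bijective_of_isometric g₁ ((injective_iff_map_eq_zero _).2 fun p hp => ?_)
      (hM.mono ?_)
    · have h := hTn p p.2
      have hp1 : (p : M × N).1 = 0 := hp
      rw [hp1, norm_zero, eq_comm, norm_eq_zero] at h
      exact Subtype.ext (Prod.ext hp1 h)
    · rintro _ ⟨p, hp, rfl⟩
      exact ⟨⟨p, Γ.le_topologicalClosure hp⟩, rfl⟩
  have hg₂ : Function.Bijective g₂ := by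
    refine bijective_of_isometric g₂ ((injective_iff_map_eq_zero _).2 fun p hp => ?_)
      (hN.mono ?_)
    · have h := hTn p p.2
      have hp2 : (p : M × N).2 = 0 := hp
      rw [hp2, norm_zero, norm_eq_zero] at h
      exact Subtype.ext (Prod.ext h hp2)
    · rintro _ ⟨p, hp, rfl⟩
      exact ⟨⟨p, Γ.le_topologicalClosure hp⟩, rfl⟩
  let e₁ := StarAlgEquiv.ofBijective g₁ hg₁
  let e₂ := StarAlgEquiv.ofBijective g₂ hg₂
  have key : ∀ p ∈ T, (e₁.symm.trans e₂) p.1 = p.2 := fun p hp => by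
    have h : e₁.symm p.1 = ⟨p, hp⟩ := e₁.symm_apply_apply (⟨p, hp⟩ : T)
    exact congrArg e₂ h
  refine ⟨⟨e₁.symm.trans e₂, fun x => ?_⟩, fun p hp => key p (Γ.le_topologicalClosure hp)⟩
  obtain ⟨p, rfl⟩ := hg₁.2 x
  have h1 := key _ (hTσ p p.2)
  have h2 := key _ p.2
  exact h1.trans (congrArg N.σ h2.symm)

theorem IsLocallyFinite.exists_countable {M : CStarSystem.{v}} (hM : IsLocallyFinite M)
    [TopologicalSpace.SeparableSpace M] :
    ∃ D : Set M, D.Countable ∧ Dense D ∧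
      ∀ x ∈ D, ∃ B : StarSubalgebra ℂ M, IsFinInvariant B ∧ x ∈ B := by
  obtain ⟨D, hD, hDc, hDd⟩ := (TopologicalSpace.IsSeparable.of_separableSpace
    {x : M | ∃ B : StarSubalgebra ℂ M, IsFinInvariant B ∧ x ∈ B}).exists_countable_dense_subset
  exact ⟨D, hDc, dense_closure.1 (hM.mono hDd), hD⟩

/-- Back-and-forth: two embeddings of a finite-dimensional system into separable locally finite
systems with the extension property are conjugate. -/
theorem exists_iso_extending {M : CStarSystem.{v}} {N : CStarSystem.{w}}
    [TopologicalSpace.SeparableSpace M] [TopologicalSpace.SeparableSpace N]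
    (hM : IsLocallyFinite M) (hN : IsLocallyFinite N)
    (hM' : HasExtension.{u} M) (hN' : HasExtension.{u} N)
    {A : CStarSystem.{u}} (hA : FinDimClass A) (φ : Emb A M) (ψ : Emb A N) :
    ∃ e : Iso M N, ∀ a, e (φ a) = ψ a := by
  classical
  obtain ⟨D, hDc, hDd, hD⟩ := hM.exists_countable
  obtain ⟨E, hEc, hEd, hE⟩ := hN.exists_countable
  have := hDc.to_subtype
  have := hEc.to_subtype
  let _ : Encodable (D ⊕ E) := Encodable.ofCountable _
  obtain ⟨Γ₀, hΓ₀, hmem₀⟩ := exists_isPartialIso hA φ ψ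
  let P := {Γ : StarSubalgebra ℂ (M × N) // IsPartialIso.{u} M N Γ}
  let C : D ⊕ E → Order.Cofinal P := Sum.elim
    (fun x => ⟨{Γ | ∃ y, ((x : M), y) ∈ Γ.1}, fun Γ => by
      obtain ⟨B, hB, hx⟩ := hD x x.2
      obtain ⟨Γ', hΓ', hle, h⟩ := Γ.2.extend_left hN' hB
      exact ⟨⟨Γ', hΓ'⟩, h x hx, hle⟩⟩)
    (fun y => ⟨{Γ | ∃ x, (x, (y : N)) ∈ Γ.1}, fun Γ => by
      obtain ⟨B, hB, hy⟩ := hE y y.2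
      obtain ⟨Γ', hΓ', hle, h⟩ := Γ.2.extend_right hM' hB
      exact ⟨⟨Γ', hΓ'⟩, h y hy, hle⟩⟩)
  -- A generic ideal of partial isomorphisms containing `Γ₀` and meeting the countably many cofinal
  -- sets, so that the union of its graphs has dense projections on both sides.
  let I := Order.idealOfCofinals (⟨Γ₀, hΓ₀⟩ : P) C
  have hdir : Directed (· ≤ ·) fun Γ : {Γ : P // Γ ∈ I} => Γ.1.1 := fun Γ₁ Γ₂ => by
    obtain ⟨Γ, hΓ, h1, h2⟩ := I.directed _ Γ₁.2 _ Γ₂.2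
    exact ⟨⟨Γ, hΓ⟩, h1, h2⟩
  have h0 : (⟨Γ₀, hΓ₀⟩ : P) ∈ I := Order.mem_idealOfCofinals _ _
  have : Nonempty {Γ : P // Γ ∈ I} := ⟨⟨_, h0⟩⟩
  let T := ⨆ Γ : {Γ : P // Γ ∈ I}, Γ.1.1
  have hT : ∀ p, p ∈ T ↔ ∃ Γ ∈ I, p ∈ Γ.1 := fun p => by
    rw [← SetLike.mem_coe, StarSubalgebra.coe_iSup_of_directed hdir, Set.mem_iUnion]
    exact ⟨fun ⟨Γ, h⟩ => ⟨Γ.1, Γ.2, h⟩, fun ⟨Γ, hΓ, h⟩ => ⟨⟨Γ, hΓ⟩, h⟩⟩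
  obtain ⟨e, he⟩ := exists_iso_of_graph T
    (fun p hp => by
      obtain ⟨⟨Γ, A, hA, φ, ψ, hΓ⟩, hI, hpΓ⟩ := (hT p).1 hp
      obtain ⟨a, rfl⟩ := hΓ.subset hpΓ
      exact (φ.norm_map a).trans (ψ.norm_map a).symm)
    (fun p hp => by
      obtain ⟨⟨Γ, A, hA, φ, ψ, hΓ⟩, hI, hpΓ⟩ := (hT p).1 hp
      obtain ⟨a, rfl⟩ := hΓ.subset hpΓ
      refine (hT _).2 ⟨_, hI, hΓ.superset ⟨A.σ a, ?_⟩⟩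
      exact Prod.ext (φ.map_σ a) (ψ.map_σ a))
    (hDd.mono fun x hx => by
      obtain ⟨Γ, ⟨y, hy⟩, hI⟩ := Order.cofinal_meets_idealOfCofinals (⟨Γ₀, hΓ₀⟩ : P) C
        (Sum.inl ⟨x, hx⟩)
      exact ⟨(x, y), (hT _).2 ⟨Γ, hI, hy⟩, rfl⟩)
    (hEd.mono fun y hy => by
      obtain ⟨Γ, ⟨x, hx⟩, hI⟩ := Order.cofinal_meets_idealOfCofinals (⟨Γ₀, hΓ₀⟩ : P) C
        (Sum.inr ⟨y, hy⟩)
      exact ⟨(x, y), (hT _).2 ⟨Γ, hI, hx⟩, rfl⟩)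
  exact ⟨e, fun a => he (φ a, ψ a) ((hT _).2 ⟨_, h0, (hmem₀ _).2 ⟨a, rfl⟩⟩)⟩

/-! ### Fraïssé limits and the extension property. -/

theorem isLocallyFinite_of_isDirectLimitOf {M : CStarSystem.{v}}
    (hM : IsDirectLimitOf FinDimClass.{u} M) : IsLocallyFinite M := by
  obtain ⟨F, -, -, hF, hd⟩ := hM
  refine hd.mono (Set.iUnion₂_subset fun B hB x hx => ?_)
  obtain ⟨A, ⟨-, hA⟩, φ, hφ⟩ := hF B hB
  refine ⟨φ.toHom.range, φ.isFinInvariant_range, ?_⟩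
  exact hφ.superset hx

theorem IsLocallyFinite.isDirectLimitOf {M : CStarSystem.{v}} [Nontrivial M]
    (hM : IsLocallyFinite M) : IsDirectLimitOf FinDimClass.{u} M := by
  let F : Set (StarSubalgebra ℂ M) := {B | IsFinInvariant B}
  have hF : DirectedOn (· ≤ ·) F := fun B hB C hC =>
    ⟨B ⊔ C, IsFinInvariant.sup hB hC, le_sup_left, le_sup_right⟩
  refine ⟨F, ?_, hF, fun B hB => IsFinInvariant.exists_emb hB, hM.mono ?_⟩
  · obtain ⟨x, B, hB, -⟩ := hM.nonempty
    exact ⟨B, hB⟩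
  · rintro x ⟨B, hB, hx⟩
    exact Set.mem_biUnion (s := F) hB hx

/-- The difference `t` of two commuting idempotents satisfies `t ^ 3 = t`, which is impossible when
`0 < ‖t‖ < 1`. -/
theorem idempotent_eq_of_norm_sub_lt {R : Type*} [NormedCommRing R] {p q : R} (hp : p * p = p)
    (hq : q * q = q) (h : ‖p - q‖ < 1) : p = q := by
  have hcube : (p - q) * ((p - q) * (p - q)) = p - q := by
    linear_combination (p - 3 * q + 1) * hp + (3 * p - q - 1) * hq
  by_contra hne
  have hpos : 0 < ‖p - q‖ := norm_pos_iff.2 (sub_ne_zero.2 hne)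
  have h1 : ‖p - q‖ ≤ ‖p - q‖ * (‖p - q‖ * ‖p - q‖) := by
    conv_lhs => rw [← hcube]
    exact (norm_mul_le _ _).trans (by gcongr; exact norm_mul_le _ _)
  nlinarith

/-- A finite-dimensional commutative C*-algebra is spanned by finitely many idempotents. -/
theorem exists_idempotents_span (A : Type u) [CommCStarAlgebra A] [FiniteDimensional ℂ A] :
    ∃ (n : ℕ) (p : Fin n → A), (∀ i, p i * p i = p i) ∧
      Submodule.span ℂ (Set.range p) = ⊤ := by
  classical
  have := finite_characterSpace A
  obtain ⟨n, ⟨e⟩⟩ := Finite.exists_equiv_fin (characterSpace ℂ A)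
  let G := gelfandStarTransform A
  let d : Fin n → C(characterSpace ℂ A, ℂ) := fun i =>
    ⟨fun x => if e x = i then 1 else 0, continuous_of_discreteTopology⟩
  refine ⟨n, fun i => G.symm (d i), fun i => ?_, eq_top_iff.2 fun a _ => ?_⟩
  · rw [← map_mul]
    congr 1
    ext x
    simp [d]
  · have h : a = ∑ i, G a (e.symm i) • G.symm (d i) := by
      apply EquivLike.injective G
      ext x
      change G a x = G _ x
      simp only [map_sum, map_smul]
      have hGd : ∀ i, G (G.symm (d i)) = d i := fun i => G.apply_symm_apply _
      simp only [hGd, ContinuousMap.sum_apply, ContinuousMap.smul_apply]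
      simp [d]
    rw [h]
    exact Submodule.sum_mem _ fun i _ => Submodule.smul_mem _ _ (Submodule.subset_span ⟨i, rfl⟩)

/-- Embed `B` by universality, then correct by an automorphism that matches the two embeddings of
`A` up to 1 on spanning idempotents. The match is then exact on these, and by linearity on `A`. -/
theorem _root_.IsFraisseLimit.hasExtension {M : CStarSystem.{v}}
    (hM : IsFraisseLimit FinDimClass.{u} M) : HasExtension.{u} M := by
  intro A B hA hB ι φ
  obtain ⟨χ⟩ := hM.universal B hB
  have := hA.2
  obtain ⟨n, p, hp, hspan⟩ := exists_idempotents_span A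
  obtain ⟨α, hα⟩ := hM.homogeneous A hA (χ.comp ι) φ n p 1 one_pos
  refine ⟨α.toEmb.comp χ, fun a => ?_⟩
  have heq : Set.EqOn (α.toEmb.comp (χ.comp ι)).toHom.toAlgHom.toLinearMap
      φ.toHom.toAlgHom.toLinearMap (Set.range p) := by
    rintro _ ⟨i, rfl⟩
    refine idempotent_eq_of_norm_sub_lt ?_ ?_ (hα i)
    · exact (map_mul (α.toEmb.comp (χ.comp ι)).toHom (p i) (p i)).symm.trans (by rw [hp]; rfl)
    · exact (map_mul φ.toHom (p i) (p i)).symm.trans (by rw [hp]; rfl)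
  exact LinearMap.eqOn_span heq (hspan ▸ Submodule.mem_top : a ∈ Submodule.span ℂ (Set.range p))

theorem isFraisseLimit_of_hasExtension {M : CStarSystem.{v}}
    [TopologicalSpace.SeparableSpace M] [Nontrivial M] (hM : IsLocallyFinite M)
    (hM' : HasExtension.{u} M) (huniv : ∀ A : CStarSystem.{u}, FinDimClass A → Nonempty (Emb A M)) :
    IsFraisseLimit FinDimClass.{u} M where
  separable := inferInstance
  directLimit := hM.isDirectLimitOf
  universal := huniv
  homogeneous A hA φ ψ n a ε hε := by
    obtain ⟨e, he⟩ := exists_iso_extending hM hM hM' hM' hA φ ψ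
    exact ⟨e, fun i => by rwa [he, sub_self, norm_zero]⟩

theorem _root_.IsFraisseLimit.nonempty_iso {M : CStarSystem.{v}} {N : CStarSystem.{w}}
    (hM : IsFraisseLimit FinDimClass.{u} M) (hN : IsFraisseLimit FinDimClass.{u} N) :
    Nonempty (Iso M N) := by
  have := hM.separable
  have := hN.separable
  obtain ⟨A, hA⟩ := isFraisseClass_finDimClass.{u}.nonempty
  obtain ⟨φ⟩ := hM.universal A hA
  obtain ⟨ψ⟩ := hN.universal A hA
  obtain ⟨e, -⟩ := exists_iso_extending (isLocallyFinite_of_isDirectLimitOf hM.directLimit)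
    (isLocallyFinite_of_isDirectLimitOf hN.directLimit) hM.hasExtension hN.hasExtension hA φ ψ
  exact ⟨e⟩

end CStarSystem

/-! ### Topology of the Cantor set. -/

/-- The disjoint sum of two Cantor spaces is a Cantor space. -/
def cantorSumHomeo : ((ℕ → Bool) ⊕ (ℕ → Bool)) ≃ₜ (ℕ → Bool) where
  toFun := Sum.elim (fun c n => Nat.casesOn n false c) (fun c n => Nat.casesOn n true c)
  invFun c := if c 0 = true then Sum.inr fun n => c (n + 1) else Sum.inl fun n => c (n + 1)
  left_inv := by rintro (c | c) <;> simp
  right_inv c := by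
    rcases h : c 0
    all_goals
      ext n
      cases n <;> simp [h]
  continuous_toFun := by
    refine continuous_sum_dom.2 ⟨continuous_pi fun n => ?_, continuous_pi fun n => ?_⟩
    all_goals
      cases n
      · exact continuous_const
      · exact continuous_apply _
  continuous_invFun := by
    refine Continuous.if (fun c hc => ?_) (by fun_prop) (by fun_prop)
    have hcl : IsClopen {c : ℕ → Bool | c 0 = true} :=
      (isClopen_discrete {true}).preimage (continuous_apply 0)
    rw [hcl.frontier_eq] at hc
    exact hc.elim

/-- Each additional copy of the Cantor space is absorbed by `cantorSumHomeo`. -/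
theorem nonempty_finProd_homeo_cantor (k : ℕ) :
    Nonempty (Fin (k + 1) × (ℕ → Bool) ≃ₜ (ℕ → Bool)) := by
  induction k with
  | zero => exact ⟨Homeomorph.uniqueProd (X := Fin 1) (Y := ℕ → Bool)⟩
  | succ k ih =>
    obtain ⟨e⟩ := ih
    have f : Fin (k + 2) ≃ₜ Fin (k + 1) ⊕ Fin 1 := 
      (finSumFinEquiv (m := k + 1) (n := 1)).symm.toHomeomorphOfDiscrete
    exact ⟨(f.prodCongr (Homeomorph.refl _)).trans <| Homeomorph.sumProdDistrib.trans <|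
      (e.sumCongr (Homeomorph.uniqueProd (X := Fin 1) (Y := ℕ → Bool))).trans cantorSumHomeo⟩

/-- A countable power of the Cantor space is a Cantor space. -/
def cantorPowHomeo : (ℕ → ℕ → Bool) ≃ₜ (ℕ → Bool) where
  toFun c n := c n.unpair.1 n.unpair.2
  invFun c i j := c (Nat.pair i j)
  left_inv c := by simp
  right_inv c := by simp
  continuous_toFun := by fun_prop
  continuous_invFun := by fun_prop

/-- Cantor space maps onto every nonempty finite discrete space. -/
theorem exists_cantor_surjection (T : Type u) [Finite T] [Nonempty T] [TopologicalSpace T] :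
    ∃ f : (ℕ → Bool) → T, Continuous f ∧ Function.Surjective f := by
  obtain ⟨n, ⟨e⟩⟩ := Finite.exists_equiv_fin T
  obtain ⟨k, rfl⟩ : ∃ k, n = k + 1 :=
    Nat.exists_eq_succ_of_ne_zero (e (Classical.arbitrary T)).pos.ne'
  obtain ⟨h⟩ := nonempty_finProd_homeo_cantor k
  refine ⟨fun c => e.symm (h.symm c).1,
    (continuous_of_discreteTopology (f := e.symm)).comp (continuous_fst.comp h.symm.continuous),
    fun t => ⟨h (e t, fun _ => false), by simp⟩⟩

/-- A continuous map from a compact product to a discrete space depends on finitely many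
coordinates. -/
theorem exists_depends_on_initial {Y : ℕ → Type u} [∀ n, TopologicalSpace (Y n)]
    [CompactSpace (∀ n, Y n)] {A : Type v} [TopologicalSpace A] [DiscreteTopology A]
    {f : (∀ n, Y n) → A} (hf : Continuous f) :
    ∃ m, ∀ x y, (∀ i < m, x i = y i) → f x = f y := by
  have h : ∀ x, ∃ (I : Finset ℕ) (U : ∀ n, Set (Y n)), (∀ i ∈ I, IsOpen (U i) ∧ x i ∈ U i) ∧
      (I : Set ℕ).pi U ⊆ f ⁻¹' {f x} := fun x =>
    isOpen_pi_iff.1 ((isOpen_discrete {f x}).preimage hf) x rfl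
  choose I U hU hsub using h
  obtain ⟨t, ht⟩ := CompactSpace.elim_nhds_subcover (fun x => (I x : Set ℕ).pi (U x)) fun x =>
    (isOpen_set_pi (I x).finite_toSet fun i hi => (hU x i hi).1).mem_nhds fun i hi => (hU x i hi).2
  -- One more than the largest coordinate restricted by a member of the finite subcover.
  refine ⟨(t.biUnion I).sup id + 1, fun x y hxy => ?_⟩
  obtain ⟨z, hz, hxz⟩ := Set.mem_iUnion₂.1 (ht.superset (Set.mem_univ x))
  have hyz : y ∈ (I z : Set ℕ).pi (U z) := fun i hi => by
    rw [← hxy i (Nat.lt_succ_of_le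
      (Finset.le_sup (f := id) (Finset.mem_biUnion.2 ⟨z, hz, hi⟩)))]
    exact hxz i hi
  exact (hsub z hxz).trans (hsub z hyz).symm

/-! ### The rotation of cycles and its lifting property. -/

/-- A product of cycles of every length and of Cantor spaces. -/
abbrev CyclicCantor : Type := ∀ n : ℕ, Fin (n + 1) × (ℕ → Bool)

namespace CyclicCantor

/-- Rotate all the cycles. -/
noncomputable def shift : CyclicCantor ≃ₜ CyclicCantor :=
  Homeomorph.piCongrRight fun n =>
    (Equiv.addRight (1 : Fin (n + 1))).toHomeomorphOfDiscrete.prodCongr (Homeomorph.refl _)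

theorem shift_apply (x : CyclicCantor) (n : ℕ) : shift x n = ((x n).1 + 1, (x n).2) := rfl

theorem nonempty_homeo_cantor : Nonempty (CyclicCantor ≃ₜ (ℕ → Bool)) := by
  exact ⟨(Homeomorph.piCongrRight fun n => (nonempty_finProd_homeo_cantor n).some).trans
    cantorPowHomeo⟩

/-- Equivariant maps onto finite systems lift along equivariant surjections of finite systems. -/
theorem exists_lift {A : Type u} {B : Type v} [Finite B] [TopologicalSpace A]
    [DiscreteTopology A] [TopologicalSpace B] [DiscreteTopology B] (τA : Equiv.Perm A)
    (τB : Equiv.Perm B) (p : B → A) (hp : Function.Surjective p) (hpτ : ∀ b, p (τB b) = τA (p b))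
    (f : CyclicCantor → A) (hf : Continuous f) (hfs : Function.Surjective f)
    (hfτ : ∀ x, f (shift x) = τA (f x)) :
    ∃ q : CyclicCantor → B, Continuous q ∧ Function.Surjective q ∧
      (∀ x, q (shift x) = τB (q x)) ∧ ∀ x, p (q x) = f x := by
  -- Coordinate `m` does not influence `f`, so its Cantor factor is free to parametrize the fibres
  -- of `p`.
  obtain ⟨m, hm⟩ := exists_depends_on_initial hf
  have hs : ∀ a : A, ∃ s : (ℕ → Bool) → {b // p b = a}, Continuous s ∧ Function.Surjective s :=
    fun a => by
      have : Nonempty {b // p b = a} := (hp a).elim fun b hb => ⟨⟨b, hb⟩⟩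
      exact exists_cantor_surjection _
  choose s hsc hss using hs
  -- Coordinate `l` carries a cycle of length exactly the order of `τB`. Its position `j` is the
  -- clock: `τB ^ j` and `τA ^ j` gain one factor under the shift, also when the cycle wraps around.
  obtain ⟨l, hl⟩ : ∃ l, orderOf τB = l + 1 :=
    Nat.exists_eq_succ_of_ne_zero (orderOf_pos τB).ne'
  have hB : τB ^ (l + 1) = 1 := hl ▸ pow_orderOf_eq_one τB
  have hpn : ∀ (n : ℕ) b, p ((τB ^ n) b) = (τA ^ n) (p b) := fun n => by
    induction n with
    | zero => exact fun b => rfl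
    | succ n ih =>
      intro b
      rw [pow_succ', Equiv.Perm.mul_apply, hpτ, ih, pow_succ', Equiv.Perm.mul_apply]
  have hA : τA ^ (l + 1) = 1 := Equiv.ext fun a => by
    obtain ⟨b, rfl⟩ := hp a
    rw [← hpn, hB]
    rfl
  let j : CyclicCantor → ℕ := fun x => (x l).1
  have hj : ∀ x, j (shift x) = (j x + 1) % (l + 1) := fun x => by
    simp only [j, shift_apply, Fin.val_add, Fin.val_one', Nat.add_mod_mod]
  have hjB : ∀ x, τB ^ j (shift x) = τB * τB ^ j x := fun x => by
    rw [hj, ← pow_succ', ← pow_eq_pow_mod _ hB]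
  have hjA : ∀ x, τA ^ j (shift x) = τA * τA ^ j x := fun x => by
    rw [hj, ← pow_succ', ← pow_eq_pow_mod _ hA]
  -- Turn `a` back to time 0, choose a point of its fibre there by means of `c`, and turn forward
  -- again upstairs. Under the shift the time-0 point and `c` do not change, whence equivariance.
  let r : ℕ → A → (ℕ → Bool) → B := fun n a c => (τB ^ n) (s ((τA ^ n).symm a) c)
  have hr : Continuous fun t : (ℕ × A) × (ℕ → Bool) => r t.1.1 t.1.2 t.2 :=
    continuous_prod_of_discrete_left.2 fun t =>
      (continuous_of_discreteTopology (f := ⇑(τB ^ t.1))).comp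
        (continuous_subtype_val.comp (hsc ((τA ^ t.1).symm t.2)))
  have hjc : Continuous j :=
    continuous_of_discreteTopology.comp (continuous_fst.comp (continuous_apply l))
  refine ⟨fun x => r (j x) (f x) (x m).2,
    hr.comp ((hjc.prodMk hf).prodMk (continuous_snd.comp (continuous_apply m))),
    fun b => ?_, fun x => ?_, fun x => ?_⟩
  · obtain ⟨x, hx⟩ := hfs (p b)
    have hb : p ((τB ^ j x).symm b) = (τA ^ j x).symm (f x) := by
      rw [Equiv.eq_symm_apply, ← hpn, Equiv.apply_symm_apply, hx]
    obtain ⟨c, hc⟩ := hss _ ⟨_, hb⟩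
    -- Only the Cantor factor changes, so the clock keeps its value even if `l = m`.
    let y : CyclicCantor := Function.update x m ((x m).1, c)
    have hfy : f y = f x := hm _ _ fun i hi => Function.update_of_ne hi.ne _ _
    have hjy : j y = j x := by
      by_cases h : l = m
      · subst h
        simp [j, y]
      · simp [j, y, Function.update_of_ne h]
    have hcy : (y m).2 = c := by simp [y]
    refine ⟨y, ?_⟩
    simp only [hfy, hjy, hcy, r, hc, Equiv.apply_symm_apply]
  · have h : (τA ^ j (shift x)).symm (f (shift x)) = (τA ^ j x).symm (f x) := by
      rw [Equiv.symm_apply_eq, hfτ, hjA, Equiv.Perm.mul_apply, Equiv.apply_symm_apply]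
    simp only [r, hjB, shift_apply, Equiv.Perm.mul_apply]
    rw [h]
  · simp only [r, hpn, (s _ _).2, Equiv.apply_symm_apply]

/-- Distinct points are separated by an equivariant map to a finite system. -/
theorem exists_separating {x y : CyclicCantor} (hxy : x ≠ y) :
    ∃ (k : ℕ) (π : CyclicCantor → Fin (k + 1) × Bool) (τ : Equiv.Perm (Fin (k + 1) × Bool)),
      Continuous π ∧ (∀ z, π (shift z) = τ (π z)) ∧ π x ≠ π y := by
  obtain ⟨k, hk⟩ := Function.ne_iff.1 hxy
  have h : ∃ i, ((x k).1, (x k).2 i) ≠ ((y k).1, (y k).2 i) := by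
    by_contra! h
    exact hk (Prod.ext (Prod.ext_iff.1 (h 0)).1 (funext fun i => (Prod.ext_iff.1 (h i)).2))
  obtain ⟨i, hi⟩ := h
  refine ⟨k, fun z => ((z k).1, (z k).2 i), (Equiv.addRight 1).prodCongr (Equiv.refl _), ?_,
    fun z => rfl, hi⟩
  exact (continuous_fst.comp (continuous_apply k)).prodMk
    ((continuous_apply i).comp (continuous_snd.comp (continuous_apply k)))

end CyclicCantor

/-! ### The Cantor system as Fraïssé limit. -/

namespace CStarSystem

section OfHomeo

variable {X : Type v} [TopologicalSpace X] [CompactSpace X]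

/-- An embedding into `C(X)` as a map from `X` to the character space. -/
noncomputable def Emb.pointDual {S : X ≃ₜ X} {A : CStarSystem.{u}} (φ : Emb A (ofHomeo S)) :
    C(X, characterSpace ℂ A) :=
  (CharacterSpace.compContinuousMap (A := A) (B := C(X, ℂ)) φ.toHom).comp
    (CharacterSpace.continuousMapEval X ℂ)

theorem Emb.pointDual_apply {S : X ≃ₜ X} {A : CStarSystem.{u}} (φ : Emb A (ofHomeo S)) (x : X)
    (a : A) : φ.pointDual x a = (show C(X, ℂ) from φ a) x := rfl

theorem Emb.pointDual_map {S : X ≃ₜ X} {A : CStarSystem.{u}} (φ : Emb A (ofHomeo S)) (x : X) :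
    φ.pointDual (S x) = A.specHomeo (φ.pointDual x) :=
  CharacterSpace.ext fun a => by
    rw [specHomeo_apply, pointDual_apply, pointDual_apply, φ.map_σ]
    rfl

theorem Emb.pointDual_surjective {S : X ≃ₜ X} {A : CStarSystem.{u}}
    [Finite (characterSpace ℂ A)] (φ : Emb A (ofHomeo S)) : Function.Surjective φ.pointDual :=
  eq_univ_of_separating (Set.range φ.pointDual) fun a ha => by
    apply φ.injective
    rw [map_zero]
    exact ContinuousMap.ext (X := X) (Y := ℂ) fun x => ha _ ⟨x, rfl⟩

/-- If equivariant maps to finite discrete systems separate the points of `X`, then `C(X)` is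
locally finite. -/
theorem isLocallyFinite_ofHomeo (S : X ≃ₜ X)
    (hsep : ∀ x y : X, x ≠ y → ∃ (F : Type) (_ : Finite F) (π : X → F) (τ : F → F),
      IsLocallyConstant π ∧ (∀ z, π (S z) = τ (π z)) ∧ π x ≠ π y) :
    IsLocallyFinite (ofHomeo S) := by
  classical
  have hbot : IsFinInvariant (⊥ : StarSubalgebra ℂ (ofHomeo S)) :=
    ⟨inferInstanceAs (FiniteDimensional ℂ (⊥ : Subalgebra ℂ (ofHomeo S))), by
      rintro _ ⟨c, rfl⟩
      exact ⟨c, (AlgHomClass.commutes (ofHomeo S).σ.toStarAlgHom c).symm⟩⟩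
  have : Nonempty {B : StarSubalgebra ℂ (ofHomeo S) // IsFinInvariant B} := ⟨⟨⊥, hbot⟩⟩
  have hdir : Directed (· ≤ ·)
      fun B : {B : StarSubalgebra ℂ (ofHomeo S) // IsFinInvariant B} => B.1 :=
    fun B C => ⟨⟨B.1 ⊔ C.1, B.2.sup C.2⟩, le_sup_left, le_sup_right⟩
  let T : StarSubalgebra ℂ C(X, ℂ) :=
    ⨆ B : {B : StarSubalgebra ℂ (ofHomeo S) // IsFinInvariant B}, B.1
  have hT : (T : Set C(X, ℂ)) =
      {x | ∃ B : StarSubalgebra ℂ (ofHomeo S), IsFinInvariant B ∧ x ∈ B} := by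
    refine (StarSubalgebra.coe_iSup_of_directed hdir).trans ?_
    ext x
    exact Set.mem_iUnion.trans ⟨fun ⟨B, h⟩ => ⟨B.1, B.2, h⟩, fun ⟨B, hB, h⟩ => ⟨⟨B, hB⟩, h⟩⟩
  -- Stone–Weierstrass: pulling back functions along an equivariant map to a finite system gives a
  -- finite-dimensional invariant subalgebra, and an indicator function in it separates the points.
  have htop : T.topologicalClosure = ⊤ := by
    refine ContinuousMap.starSubalgebra_topologicalClosure_eq_top_of_separatesPoints T ?_
    intro x y hxy
    obtain ⟨F, hF, π, τ, hπ, hτ, hne⟩ := hsep x y hxy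
    let _ : TopologicalSpace F := ⊥
    have : DiscreteTopology F := ⟨rfl⟩
    have : FiniteDimensional ℂ C(F, ℂ) := FiniteDimensional.of_injective
      (ContinuousMap.coeFnLinearMap ℂ : C(F, ℂ) →ₗ[ℂ] (F → ℂ)) DFunLike.coe_injective
    let g : C(F, ℂ) →⋆ₐ[ℂ] C(X, ℂ) := ContinuousMap.compStarAlgHom' ℂ ℂ ⟨π, hπ.continuous⟩
    have hg : IsFinInvariant (M := ofHomeo S) (StarAlgHom.range g) :=
      isFinInvariant_range (M := ofHomeo S) g fun a =>
        ⟨a.comp ⟨τ, continuous_of_discreteTopology⟩,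
          ContinuousMap.ext (X := X) (Y := ℂ) fun z => congrArg a (hτ z).symm⟩
    let d : C(F, ℂ) := ⟨fun t => if t = π x then 1 else 0, continuous_of_discreteTopology⟩
    refine ⟨g d, ⟨g d, hT.superset ⟨_, hg, d, rfl⟩, rfl⟩, ?_⟩
    change (if π x = π x then (1 : ℂ) else 0) ≠ if π y = π x then 1 else 0
    rw [if_pos rfl, if_neg hne.symm]
    exact one_ne_zero
  have hdense : Dense (T : Set C(X, ℂ)) := fun x => by
    rw [← StarSubalgebra.topologicalClosure_coe, htop]
    trivial
  rw [hT] at hdense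
  exact hdense

end OfHomeo

/-- The rotation of `CyclicCantor`, transported to the Cantor set. -/
noncomputable def cantorRotation : (ℕ → Bool) ≃ₜ (ℕ → Bool) :=
  CyclicCantor.nonempty_homeo_cantor.some.symm.trans
    (CyclicCantor.shift.trans CyclicCantor.nonempty_homeo_cantor.some)

theorem exists_cantorRotation_lift {A : Type u} {B : Type v} [Finite B] [TopologicalSpace A]
    [DiscreteTopology A] [TopologicalSpace B] [DiscreteTopology B] (τA : Equiv.Perm A)
    (τB : Equiv.Perm B) (p : B → A) (hp : Function.Surjective p) (hpτ : ∀ b, p (τB b) = τA (p b))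
    (f : (ℕ → Bool) → A) (hf : Continuous f) (hfs : Function.Surjective f)
    (hfτ : ∀ x, f (cantorRotation x) = τA (f x)) :
    ∃ q : (ℕ → Bool) → B, Continuous q ∧ Function.Surjective q ∧
      (∀ x, q (cantorRotation x) = τB (q x)) ∧ ∀ x, p (q x) = f x := by
  let e := CyclicCantor.nonempty_homeo_cantor.some
  have he : ∀ x, cantorRotation (e x) = e (CyclicCantor.shift x) := fun x =>
    congrArg (fun y => e (CyclicCantor.shift y)) (e.symm_apply_apply x)
  obtain ⟨q, hq, hqs, hqτ, hpq⟩ := CyclicCantor.exists_lift τA τB p hp hpτ (f ∘ e)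
    (hf.comp e.continuous) (hfs.comp e.surjective) fun x => by
      rw [Function.comp_apply, ← he, hfτ, Function.comp_apply]
  refine ⟨q ∘ e.symm, hq.comp e.symm.continuous, hqs.comp e.symm.surjective, fun x => ?_,
    fun x => ?_⟩
  · obtain ⟨x, rfl⟩ := e.surjective x
    rw [he]
    simp [hqτ]
  · simp [hpq]

theorem isLocallyFinite_cantorRotation : IsLocallyFinite (ofHomeo cantorRotation) := by
  let e := CyclicCantor.nonempty_homeo_cantor.some
  refine isLocallyFinite_ofHomeo _ fun x y hxy => ?_
  obtain ⟨k, π, τ, hπ, hτ, hne⟩ := CyclicCantor.exists_separating (e.symm.injective.ne hxy)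
  refine ⟨_, inferInstance, π ∘ e.symm, τ,
    (IsLocallyConstant.iff_continuous _).2 (hπ.comp e.symm.continuous), fun z => ?_, hne⟩
  have h : e.symm (cantorRotation z) = CyclicCantor.shift (e.symm z) := e.symm_apply_apply _
  rw [Function.comp_apply, h, hτ, Function.comp_apply]

/-- Dually, the surjection of the Cantor set onto the spectrum of `A` is lifted through the dual of
`ι`. -/
theorem hasExtension_cantorRotation : HasExtension.{u} (ofHomeo cantorRotation) := by
  intro A B hA hB ι φ
  have := hA.2
  have := hB.2
  have := finite_characterSpace A
  have := finite_characterSpace B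
  obtain ⟨q, hq, hqs, hqτ, hpq⟩ := exists_cantorRotation_lift A.specHomeo.toEquiv
    B.specHomeo.toEquiv ι.dual ι.dual_surjective ι.dual_specHomeo φ.pointDual
    φ.pointDual.continuous φ.pointDual_surjective φ.pointDual_map
  exact ⟨embOfSpec cantorRotation B ⟨q, hq⟩ hqs hqτ, fun a =>
    ContinuousMap.ext (X := ℕ → Bool) (Y := ℂ) fun x => DFunLike.congr_fun (hpq x) a⟩

theorem isFraisseLimit_cantorRotation :
    IsFraisseLimit FinDimClass.{u} (ofHomeo cantorRotation) := by
  have : TopologicalSpace.SeparableSpace (ofHomeo cantorRotation) :=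
    inferInstanceAs (TopologicalSpace.SeparableSpace C(ℕ → Bool, ℂ))
  have : Nontrivial (ofHomeo cantorRotation) := inferInstanceAs (Nontrivial C(ℕ → Bool, ℂ))
  refine isFraisseLimit_of_hasExtension isLocallyFinite_cantorRotation
    hasExtension_cantorRotation fun A hA => ?_
  have := hA.1
  have := hA.2
  have := finite_characterSpace A
  -- Universality is the case of lifting over a one-point system.
  obtain ⟨q, hq, hqs, hqτ, -⟩ := exists_cantorRotation_lift (A := Unit) 1
    A.specHomeo.toEquiv (fun _ => ()) (fun _ => ⟨Classical.arbitrary _, rfl⟩) (fun _ => rfl)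
    (fun _ => ()) continuous_const (fun _ => ⟨fun _ => false, rfl⟩) fun _ => rfl
  exact ⟨embOfSpec cantorRotation A ⟨q, hq⟩ hqs hqτ⟩

end CStarSystem

theorem theorem4p1 :
    IsFraisseClass FinDimClass.{u} ∧
    ∃ S : (ℕ → Bool) ≃ₜ (ℕ → Bool),
      IsFraisseLimit FinDimClass.{u} (CStarSystem.ofHomeo S) ∧
      ∀ M : CStarSystem.{v}, IsFraisseLimit FinDimClass.{u} M →
        Nonempty (CStarSystem.Iso M (CStarSystem.ofHomeo S)) :=
  ⟨isFraisseClass_finDimClass, cantorRotation, isFraisseLimit_cantorRotation,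
    fun _ hM => hM.nonempty_iso isFraisseLimit_cantorRotation⟩
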